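/- Algebraic spaces are understood as étale sheaves of sets on the category of schemes whose diagonal is representable by schemes and which admit an étale surjective morphism from a scheme; no separation condition is imposed. A morphism $f\colon S'\to S$ of algebraic spaces is called \emph{schematically dominant} if $\mathcal{O}_S\to f_*\mathcal{O}_{S'}$ is injective as a map of sheaves on the small étale site of $S$, and \emph{submersive} if $|f|\colon |S'|\to |S|$ is surjective and $|S|$ carries the quotient topology. Let $f\colon S'\to S$ be a morphism of algebraic spaces which is schematically dominant and such that, for every étale morphism of algebraic spaces $T\to S$, the base change $S'\times_S T\to T$ is submersive. Then $f$ is an epimorphism in the category of algebraic spaces, and for every étale morphism of algebraic spaces $T\to S$ the base change $S'\times_S T\to T$ is an epimorphism in the category of algebraic spaces. -/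

import Mathlib

universe u

open CategoryTheory Limits AlgebraicGeometry Opposite

namespace AlgebraicGeometry

/-- Presheaves of sets on the category of schemes. -/
abbrev SchPresheaf : Type (u + 1) := Scheme.{u}ᵒᵖ ⥤ Type u

/-- A presheaf on the category of schemes is an algebraic space if it is a sheaf for the étale
topology, its diagonal is representable (by schemes), and it receives an étale surjective
(representable) morphism from a scheme. No separation condition is imposed. -/
structure IsAlgebraicSpace (F : SchPresheaf.{u}) : Prop where
  isSheaf : Presheaf.IsSheaf Scheme.etaleTopology.{u} F
  representable_diag : yoneda.relativelyRepresentable (Limits.diag F)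
  exists_atlas : ∃ (U : Scheme.{u}) (a : yoneda.obj U ⟶ F),
    MorphismProperty.presheaf @Etale a ∧ MorphismProperty.presheaf @Surjective a

/-- The category of algebraic spaces, a full subcategory of presheaves on schemes. -/
abbrev AlgebraicSpace : Type (u + 1) :=
  ObjectProperty.FullSubcategory (C := SchPresheaf.{u}) IsAlgebraicSpace

namespace SchPresheaf

/-! ### The underlying topological space -/

/-- A field-valued point `Spec K ⟶ F`, given as an element of `F(Spec K)`. -/
structure FieldPoint (F : SchPresheaf.{u}) : Type (u + 1) where
  K : Type u
  [field : Field K]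
  pt : F.obj (op (Spec (CommRingCat.of K)))

attribute [instance] FieldPoint.field

/-- Two field-valued points are equivalent if they agree on some common field extension. -/
def FieldPoint.Rel {F : SchPresheaf.{u}} (x y : FieldPoint F) : Prop :=
  ∃ (Ω : Type u) (_ : Field Ω) (i : x.K →+* Ω) (j : y.K →+* Ω),
    F.map (Spec.map (CommRingCat.ofHom i)).op x.pt =
      F.map (Spec.map (CommRingCat.ofHom j)).op y.pt

/-- Two extensions of a field have a common extension. -/
theorem exists_common_extension {k K L : Type u} [Field k] [Field K] [Field L]
    (i : k →+* K) (j : k →+* L) :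
    ∃ (Ω : Type u) (_ : Field Ω) (a : K →+* Ω) (b : L →+* Ω), a.comp i = b.comp j := by
  let := i.toAlgebra
  let := j.toAlgebra
  obtain ⟨m, hm⟩ := Ideal.exists_maximal (TensorProduct k K L)
  let := Ideal.Quotient.field m
  refine ⟨TensorProduct k K L ⧸ m, inferInstance,
    (Ideal.Quotient.mk m).comp Algebra.TensorProduct.includeLeftRingHom,
    (Ideal.Quotient.mk m).comp
      (Algebra.TensorProduct.includeRight : L →ₐ[k] TensorProduct k K L).toRingHom, ?_⟩
  ext x
  exact congrArg (Ideal.Quotient.mk m)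
    (((Algebra.TensorProduct.includeLeft : K →ₐ[k] TensorProduct k K L).commutes x).trans
    ((Algebra.TensorProduct.includeRight : L →ₐ[k] TensorProduct k K L).commutes x).symm)

theorem map_map_spec (F : SchPresheaf.{u}) {k K L : Type u} [Field k] [Field K] [Field L]
    (i : k →+* K) (j : K →+* L) (x : F.obj (op (Spec (CommRingCat.of k)))) :
    F.map (Spec.map (CommRingCat.ofHom j)).op (F.map (Spec.map (CommRingCat.ofHom i)).op x) =
      F.map (Spec.map (CommRingCat.ofHom (j.comp i))).op x := by
  rw [CommRingCat.ofHom_comp, Spec.map_comp, op_comp, F.map_comp]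
  rfl

/-- The equivalence relation defining the points of a presheaf. -/
instance fieldPointSetoid (F : SchPresheaf.{u}) : Setoid (FieldPoint F) where
  r := FieldPoint.Rel
  iseqv :=
    { refl := fun x => ⟨x.K, inferInstance, RingHom.id _, RingHom.id _, rfl⟩
      symm := fun ⟨Ω, _, i, j, h⟩ => ⟨Ω, inferInstance, j, i, h.symm⟩
      trans := by
        rintro x y z ⟨Ω, _, i, j, h⟩ ⟨Ω', _, i', j', h'⟩
        obtain ⟨Ω'', _, a, b, hab⟩ := exists_common_extension j i'
        refine ⟨Ω'', inferInstance, a.comp i, b.comp j', ?_⟩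
        rw [← map_map_spec, h, map_map_spec, hab, ← map_map_spec, h', map_map_spec] }

/-- The set of points `|F|`: equivalence classes of field-valued points. -/
def Points (F : SchPresheaf.{u}) : Type (u + 1) := Quotient (fieldPointSetoid F)

/-- The image in `|F|` of a point `x` of a scheme `U` under `g : U ⟶ F`. -/
noncomputable def pointOf {F : SchPresheaf.{u}} {U : Scheme.{u}} (g : yoneda.obj U ⟶ F)
    (x : U) : F.Points :=
  Quotient.mk (fieldPointSetoid F)
    ⟨U.residueField x, g.app (op (Spec (U.residueField x))) (U.fromSpecResidueField x)⟩

/-- The topology on `|F|`: a set is open if its preimage in every scheme étale over `F` is. -/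
instance (F : SchPresheaf.{u}) : TopologicalSpace F.Points where
  IsOpen A := ∀ ⦃U : Scheme.{u}⦄ (g : yoneda.obj U ⟶ F),
    MorphismProperty.presheaf @Etale g → IsOpen (pointOf g ⁻¹' A)
  isOpen_univ := fun _ _ _ => isOpen_univ
  isOpen_inter := fun _ _ hA hB _ g hg => (hA g hg).inter (hB g hg)
  isOpen_sUnion := fun A hA U g hg => by
    rw [Set.preimage_sUnion]
    exact isOpen_biUnion fun B hB => hA B hB g hg

/-- The map `|F| → |G|` induced by a morphism `F ⟶ G`. -/
noncomputable def mapPoints {F G : SchPresheaf.{u}} (f : F ⟶ G) : F.Points → G.Points :=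
  Quotient.map (fun x => ⟨x.K, f.app _ x.pt⟩) (by
    rintro x y ⟨Ω, _, i, j, h⟩
    refine ⟨Ω, inferInstance, i, j, ?_⟩
    change G.map _ (f.app _ x.pt) = G.map _ (f.app _ y.pt)
    rw [← NatTrans.naturality_apply, ← NatTrans.naturality_apply, h])

/-- The presheaf `T ↦ Γ(T, 𝒪_T)` on schemes. Morphisms `F ⟶ structurePresheaf` are the
global functions on `F`. -/
noncomputable def structurePresheaf : SchPresheaf.{u} := Scheme.Γ ⋙ forget CommRingCat.{u}

end SchPresheaf

namespace AlgebraicSpace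

variable {X Y : AlgebraicSpace.{u}}

/-- A morphism `f : X ⟶ Y` of algebraic spaces (not necessarily representable) is étale if
for some étale surjective `U ⟶ X` from a scheme, the composite `U ⟶ Y` is étale. -/
def IsEtale (f : X ⟶ Y) : Prop :=
  ∃ (U : Scheme.{u}) (a : yoneda.obj U ⟶ X.obj),
    MorphismProperty.presheaf @Etale a ∧ MorphismProperty.presheaf @Surjective a ∧
    MorphismProperty.presheaf @Etale (a ≫ f.hom)

/-- A morphism of algebraic spaces is submersive if it is surjective on points and the target
carries the quotient topology. -/
def IsSubmersive (f : X ⟶ Y) : Prop :=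
  Topology.IsQuotientMap (SchPresheaf.mapPoints f.hom)

/-- A morphism `f : X ⟶ Y` of algebraic spaces is schematically dominant if `𝒪_Y ⟶ f_* 𝒪_X` is
injective on the small étale site of `Y`: for every scheme `U` étale over `Y`, pullback of
functions from `U` to `X ×_Y U` is injective. -/
def IsSchematicallyDominant (f : X ⟶ Y) : Prop :=
  ∀ ⦃U : Scheme.{u}⦄ (g : yoneda.obj U ⟶ Y.obj), MorphismProperty.presheaf @Etale g →
    Function.Injective
      (fun s : yoneda.obj U ⟶ SchPresheaf.structurePresheaf => pullback.snd f.hom g ≫ s)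

end AlgebraicSpace

end AlgebraicGeometry

/-!
Testing on an étale atlas of the base, let `U` be a scheme étale over `S` and let `a, b : U ⟶ Z`
agree on all schemes over `U` that lift to `S'`. If `V ⟶ Z` is an étale atlas, the pairs of lifts
of `a` and `b` to `V` are parametrised by a scheme `Q` étale over `U`; let `E ⟶ Q` be the
equalizer of the two maps `Q ⟶ V`. It is an immersion, and it becomes an open immersion over every
scheme that lifts to `S'`, because there it is a base change of the diagonal of the étale map
`V ⟶ Z`. Submersivity makes the range of `E ⟶ Q` open, and schematic dominance makes its stalk maps
injective, so `E ⟶ Q` is itself an open immersion. Hence `E ⟶ U` is étale; it is surjective since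
every point of `U` comes from `S' ×_S U`, and `a = b` on `E`, so `a = b` by étale descent.
-/

namespace AlgebraicSpaceEpi

open SchPresheaf

theorem isPullback_equalizer_ι_comp {C : Type*} [Category* C] [HasEqualizers C] {X Y Z : C}
    (r s : Y ⟶ Z) (h : X ⟶ Y) :
    IsPullback
      (equalizer.lift (equalizer.ι (h ≫ r) (h ≫ s) ≫ h)
        (by simpa using equalizer.condition (h ≫ r) (h ≫ s)))
      (equalizer.ι (h ≫ r) (h ≫ s)) (equalizer.ι r s) h :=
  .of_isLimit' ⟨by simp⟩ <| PullbackCone.IsLimit.mk _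
    (fun c ↦ equalizer.lift c.snd (by
      rw [← reassoc_of% c.condition, ← reassoc_of% c.condition, equalizer.condition]))
    (fun c ↦ by ext; simp [c.condition]) (fun c ↦ by simp)
    (fun c m _ hm ↦ by ext; simpa using hm)

theorem isIso_equalizer_ι_comp_snd {C D : Type*} [Category* C] [HasEqualizers C] [Category* D]
    {F : C ⥤ D} [F.Full] [F.Faithful] {V : C} {Z : D} {v : F.obj V ⟶ Z}
    (hv : F.relativelyRepresentable v) :
    IsIso (equalizer.ι (hv.fst' v) (hv.snd v) ≫ hv.snd v) :=
  ⟨equalizer.lift (hv.lift' (𝟙 V) (𝟙 V) rfl) (by simp),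
    equalizer.hom_ext (hv.hom_ext' (by simp [equalizer.condition]) (by simp)), by simp⟩

theorem isOpenImmersion_equalizer_ι {X V : Scheme.{u}} {Z : SchPresheaf.{u}}
    {v : yoneda.obj V ⟶ Z} (hv : MorphismProperty.presheaf @Etale v) {r s : X ⟶ V}
    (h : yoneda.map r ≫ v = yoneda.map s ≫ v) : IsOpenImmersion (equalizer.ι r s) := by
  -- The diagonal of `v` is a section of an étale morphism, hence étale, and it is a monomorphism.
  have hdiag : IsOpenImmersion (equalizer.ι (hv.rep.fst' v) (hv.rep.snd v)) := by
    have : Etale (hv.rep.snd v) := hv.property_snd v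
    have := isIso_equalizer_ι_comp_snd hv.rep
    have := Etale.of_comp (equalizer.ι (hv.rep.fst' v) (hv.rep.snd v)) (hv.rep.snd v)
    exact IsOpenImmersion.of_flat_of_mono _
  obtain ⟨ρ, rfl, rfl⟩ : ∃ ρ, ρ ≫ hv.rep.fst' v = r ∧ ρ ≫ hv.rep.snd v = s :=
    ⟨hv.rep.lift' r s h, by simp, by simp⟩
  exact MorphismProperty.of_isPullback (isPullback_equalizer_ι_comp _ _ ρ) hdiag

theorem isOpenImmersion_pullback_snd_equalizer_ι {X Y V : Scheme.{u}} {Z : SchPresheaf.{u}}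
    {v : yoneda.obj V ⟶ Z} (hv : MorphismProperty.presheaf @Etale v) {r s : Y ⟶ V} {h : X ⟶ Y}
    (hrs : yoneda.map (h ≫ r) ≫ v = yoneda.map (h ≫ s) ≫ v) :
    IsOpenImmersion (pullback.snd (equalizer.ι r s) h) := by
  have := isOpenImmersion_equalizer_ι hv hrs
  rw [← (isPullback_equalizer_ι_comp r s h).isoPullback_inv_snd]
  infer_instance

section

variable {E W : Scheme.{u}} {i : E ⟶ W}

theorem app_eq_zero_of_isOpenImmersion_pullback_snd {X : Scheme.{u}} (h : X ⟶ W)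
    [IsOpenImmersion (pullback.snd i h)] {B : W.Opens} (hB : (B : Set W) ⊆ Set.range i)
    {s : Γ(W, B)} (hs : i.app B s = 0) : h.app B s = 0 := by
  have hle : h ⁻¹ᵁ B ≤ (pullback.snd i h).opensRange := by
    rw [← SetLike.coe_subset_coe, Scheme.Hom.coe_opensRange, Scheme.Pullback.range_snd]
    exact Set.preimage_mono hB
  have := (pullback.snd i h).isIso_app _ hle
  apply (ConcreteCategory.bijective_of_isIso ((pullback.snd i h).app (h ⁻¹ᵁ B))).1
  have hcomp : h.app B ≫ (pullback.snd i h).app (h ⁻¹ᵁ B) =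
      i.app B ≫ (pullback.fst i h).app (i ⁻¹ᵁ B) ≫
        (pullback i h).presheaf.map (eqToHom (by
          rw [← Scheme.Hom.comp_preimage, ← Scheme.Hom.comp_preimage, pullback.condition])).op :=
    Scheme.Hom.congr_app pullback.condition.symm B
  rw [← ConcreteCategory.comp_apply, hcomp, ConcreteCategory.comp_apply, hs, map_zero, map_zero]

theorem stalkMap_injective_of_forall_app_eq_zero (hi : Topology.IsOpenEmbedding i)
    (eq_zero_of : ∀ (B : W.Opens) (s : Γ(W, B)), (B : Set W) ⊆ Set.range i → i.app B s = 0 → s = 0)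
    (x : E) : Function.Injective (i.stalkMap x) := by
  refine (injective_iff_map_eq_zero (i.stalkMap x).hom).2 fun t ht ↦ ?_
  obtain ⟨B, _, hxB, s, rfl⟩ := W.presheaf.exists_le_germ_eq t
    (V := ⟨Set.range i, hi.isOpen_range⟩) ⟨x, rfl⟩
  replace ht : E.presheaf.germ (i ⁻¹ᵁ B) x hxB (i.app B s) =
      E.presheaf.germ (i ⁻¹ᵁ B) x hxB 0 := by
    rw [← Scheme.Hom.germ_stalkMap_apply, map_zero]
    exact ht
  obtain ⟨D, hxD, hDB, _, hD⟩ := E.presheaf.germ_eq x _ _ _ _ ht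
  let C : W.Opens := ⟨i '' D, hi.isOpenMap _ D.2⟩
  have hCB : C ≤ B := Set.image_subset_iff.2 (leOfHom hDB)
  have hCD : i ⁻¹ᵁ C = D := TopologicalSpace.Opens.ext (hi.injective.preimage_image _)
  have hres : W.presheaf.map (homOfLE hCB).op s = 0 := by
    refine eq_zero_of C _ (Set.image_subset_range _ _) ?_
    have hmap : W.presheaf.map (homOfLE hCB).op ≫ i.app C =
        i.app B ≫ E.presheaf.map hDB.op ≫ E.presheaf.map (homOfLE hCD.le).op := by
      rw [i.naturality, ← Functor.map_comp]
      rfl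
    rw [← ConcreteCategory.comp_apply, hmap, ConcreteCategory.comp_apply,
      ConcreteCategory.comp_apply, hD, map_zero, map_zero]
  rw [← W.presheaf.germ_res_apply (homOfLE hCB) (i x) ⟨x, hxD, rfl⟩, hres, map_zero]

theorem isOpenImmersion_of_forall_pullback_snd [IsPreimmersion i] (𝒮 : Presieve W)
    (isOpen_of : ∀ A : Set W, (∀ ⦃X : Scheme.{u}⦄ (h : X ⟶ W), 𝒮 h → IsOpen (h ⁻¹' A)) → IsOpen A)
    (eq_zero_of : ∀ (B : W.Opens) (s : Γ(W, B)),
      (∀ ⦃X : Scheme.{u}⦄ (h : X ⟶ W), 𝒮 h → h.app B s = 0) → s = 0)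
    (hi : ∀ ⦃X : Scheme.{u}⦄ (h : X ⟶ W), 𝒮 h → IsOpenImmersion (pullback.snd i h)) :
    IsOpenImmersion i := by
  have hrange : IsOpen (Set.range i) := isOpen_of _ fun X h hh ↦ by
    have := hi h hh
    rw [← Scheme.Pullback.range_snd]
    exact (pullback.snd i h).isOpenEmbedding.isOpen_range
  have hemb : Topology.IsOpenEmbedding i := ⟨i.isEmbedding, hrange⟩
  refine IsOpenImmersion.iff_isIso_stalkMap.2 ⟨hemb, fun x ↦ ?_⟩
  refine (ConcreteCategory.isIso_iff_bijective _).2 ⟨?_, i.stalkMap_surjective x⟩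
  refine stalkMap_injective_of_forall_app_eq_zero hemb (fun B s hB hs ↦ ?_) x
  refine eq_zero_of B s fun X h hh ↦ ?_
  have := hi h hh
  exact app_eq_zero_of_isOpenImmersion_pullback_snd h hB hs

end

section

variable {F G : SchPresheaf.{u}}

theorem presheaf_id_yoneda_obj {P : MorphismProperty Scheme.{u}} [P.IsStableUnderBaseChange]
    {W : Scheme.{u}} (h : P (𝟙 W)) : P.presheaf (𝟙 (yoneda.obj W)) := by
  rw [← yoneda.map_id]
  exact MorphismProperty.relative_map h

theorem presheaf_etale_map_comp {X Y : Scheme.{u}} (q : X ⟶ Y) [hq : Etale q]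
    {w : yoneda.obj Y ⟶ F} (hw : MorphismProperty.presheaf @Etale w) :
    MorphismProperty.presheaf @Etale (yoneda.map q ≫ w) :=
  have : MorphismProperty.IsStableUnderComposition (@Etale.{u}) :=
    Etale.instIsMultiplicativeScheme.toIsStableUnderComposition
  (MorphismProperty.relative_isStableUnderComposition (F := yoneda) _).comp_mem _ _
    (MorphismProperty.relative_map hq) hw

theorem isAlgebraicSpace_yoneda_obj (W : Scheme.{u}) : IsAlgebraicSpace (yoneda.obj W) where
  isSheaf := by
    rw [isSheaf_iff_isSheaf_of_type]
    have : Scheme.etaleTopology.{u}.Subcanonical :=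
      .of_le Scheme.etaleTopology_le_proetaleTopology
    exact GrothendieckTopology.Subcanonical.isSheaf_of_isRepresentable _
  representable_diag := by
    rw [Functor.relativelyRepresentable.diag_iff]
    intro a g
    obtain ⟨g, rfl⟩ := yoneda.map_surjective g
    exact .map yoneda g
  exists_atlas := ⟨W, 𝟙 _, presheaf_id_yoneda_obj (P := @Etale) inferInstance,
    presheaf_id_yoneda_obj (P := @Surjective) inferInstance⟩

theorem relativelyRepresentable_of_comp {p : F ⟶ G} (hp : yoneda.relativelyRepresentable p)
    {X : Scheme.{u}} {g : yoneda.obj X ⟶ F} (h : yoneda.relativelyRepresentable (g ≫ p)) :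
    yoneda.relativelyRepresentable g := by
  have hg : yoneda.map (hp.lift g (𝟙 X) (by simp)) ≫ hp.fst (g ≫ p) = g := by simp
  rw [← hg]
  exact MorphismProperty.comp_mem _ _ _ (.map yoneda _)
    (MorphismProperty.of_isPullback (hp.isPullback (g ≫ p)).flip h)

theorem isAlgebraicSpace_of_isPullback {P : SchPresheaf.{u}} {W : Scheme.{u}} {fst : P ⟶ F}
    {snd : P ⟶ yoneda.obj W} {f : F ⟶ G} {g : yoneda.obj W ⟶ G} (sq : IsPullback fst snd f g)
    (hF : IsAlgebraicSpace F) (hG : IsAlgebraicSpace G) (hg : yoneda.relativelyRepresentable g) :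
    IsAlgebraicSpace P := by
  have hfst : yoneda.relativelyRepresentable fst := MorphismProperty.of_isPullback sq.flip hg
  refine ⟨?isSheaf, ?representable_diag, ?exists_atlas⟩
  case isSheaf =>
    let c : cospan (C := Sheaf Scheme.etaleTopology.{u} (Type u)) (X := ⟨F, hF.isSheaf⟩)
        (Y := ⟨yoneda.obj W, (isAlgebraicSpace_yoneda_obj W).isSheaf⟩) (Z := ⟨G, hG.isSheaf⟩)
        ⟨f⟩ ⟨g⟩ ⋙ sheafToPresheaf _ _ ≅ cospan f g := cospanCompIso _ _ _
    exact Sheaf.isSheaf_of_isLimit _ _ ((IsLimit.postcomposeInvEquiv c _).symm sq.isLimit)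
  case representable_diag =>
    rw [Functor.relativelyRepresentable.diag_iff]
    exact fun _ _ ↦ relativelyRepresentable_of_comp hfst
      (Functor.relativelyRepresentable.diag_iff.1 hF.representable_diag _)
  case exists_atlas =>
    obtain ⟨U, a, ha_etale, ha_surj⟩ := hF.exists_atlas
    have hpullback := (hfst.isPullback a).flip
    exact ⟨_, hfst.fst a,
      (MorphismProperty.relative_isStableUnderBaseChange _).of_isPullback hpullback ha_etale,
      (MorphismProperty.relative_isStableUnderBaseChange _).of_isPullback hpullback ha_surj⟩

theorem hom_ext_of_etale_surjective (hG : Presheaf.IsSheaf Scheme.etaleTopology.{u} G)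
    {O : Scheme.{u}} {c : yoneda.obj O ⟶ F} (hc_etale : MorphismProperty.presheaf @Etale c)
    (hc_surj : MorphismProperty.presheaf @Surjective c) {a b : F ⟶ G} (h : c ≫ a = c ≫ b) :
    a = b := by
  refine hom_ext_yoneda fun X x ↦ yonedaEquiv.injective ?_
  have hcover : Presieve.singleton (hc_etale.rep.snd x) ∈ Scheme.precoverage @Etale X :=
    (Scheme.singleton_mem_precoverage_iff _ _).2
      ⟨(hc_surj.property _ _ _ (hc_etale.rep.isPullback x)).surj, hc_etale.property_snd x⟩
  refine (((isSheaf_iff_isSheaf_of_type _ _).1 hG).isSheafFor_of_mem_precoverage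
    hcover).isSeparatedFor.ext ?_
  rintro Y _ ⟨⟩
  have hcomp : yoneda.map (hc_etale.rep.snd x) ≫ x ≫ a =
      yoneda.map (hc_etale.rep.snd x) ≫ x ≫ b := by
    rw [← hc_etale.rep.w_assoc, ← hc_etale.rep.w_assoc, h]
  simpa only [yonedaEquiv_naturality] using congrArg yonedaEquiv hcomp

end

section

variable {F : SchPresheaf.{u}} {W : Scheme.{u}}

theorem exists_pointOf_eq (t : F.Points) :
    ∃ (U : Scheme.{u}) (g : yoneda.obj U ⟶ F) (x : U), pointOf g x = t := by
  obtain ⟨⟨K, pt⟩, rfl⟩ := Quotient.exists_rep t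
  let x : Spec (.of K) := IsLocalRing.closedPoint K
  obtain ⟨φ, hφ⟩ := Spec.map_surjective ((Spec (.of K)).fromSpecResidueField x)
  refine ⟨Spec (.of K), yonedaEquiv.symm pt, x, Quotient.sound
    ⟨(Spec (.of K)).residueField x, inferInstance, RingHom.id _, φ.hom, ?_⟩⟩
  have hφ' : Spec.map (CommRingCat.ofHom φ.hom) = (Spec (.of K)).fromSpecResidueField x := hφ
  rw [hφ', CommRingCat.ofHom_id, Spec.map_id, op_id, Functor.map_id_apply]
  exact yonedaEquiv_symm_app_apply _ _ _

theorem specMap_comp_closedPoint {K L : Type u} [Field K] [Field L] (i : K →+* L)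
    (y : Spec (.of K) ⟶ W) :
    (Spec.map (CommRingCat.ofHom i) ≫ y) (IsLocalRing.closedPoint L) =
      y (IsLocalRing.closedPoint K) :=
  congrArg y (Subsingleton.elim (α := PrimeSpectrum K) _ _)

/-- The point of the scheme `W` underlying a point of its functor of points. -/
noncomputable def schemePoint : SchPresheaf.Points (yoneda.obj W) → W :=
  Quotient.lift
    (fun p : FieldPoint (yoneda.obj W) ↦
      (show Spec (.of p.K) ⟶ W from p.pt) (IsLocalRing.closedPoint p.K)) (by
    rintro p q ⟨Ω, _, i, j, h⟩
    rw [← specMap_comp_closedPoint i, ← specMap_comp_closedPoint j]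
    exact congrArg (fun y : Spec (.of Ω) ⟶ W ↦ y (IsLocalRing.closedPoint Ω)) h)

theorem schemePoint_pointOf_map {U : Scheme.{u}} (h : U ⟶ W) (x : U) :
    schemePoint (pointOf (yoneda.map h) x) = h x :=
  congrArg h (Scheme.fromSpecResidueField_apply x _)

theorem pointOf_map_preimage_schemePoint_preimage {U : Scheme.{u}} (h : U ⟶ W) (A : Set W) :
    pointOf (yoneda.map h) ⁻¹' (schemePoint ⁻¹' A) = h ⁻¹' A := by
  ext x
  rw [Set.mem_preimage, Set.mem_preimage, schemePoint_pointOf_map, Set.mem_preimage]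

theorem isQuotientMap_schemePoint : Topology.IsQuotientMap (schemePoint (W := W)) := by
  refine ⟨Topology.isCoinducing_iff.2 fun A ↦ ⟨fun hA ↦ ?_, fun hA U g _ ↦ ?_⟩,
    fun x ↦ ⟨pointOf (yoneda.map (𝟙 W)) x, schemePoint_pointOf_map (𝟙 W) x⟩⟩
  · have := hA (yoneda.map (𝟙 W)) (MorphismProperty.relative_map (inferInstanceAs (Etale (𝟙 W))))
    rwa [pointOf_map_preimage_schemePoint_preimage] at this
  · obtain ⟨h, rfl⟩ := yoneda.map_surjective g
    rw [pointOf_map_preimage_schemePoint_preimage]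
    exact hA.preimage h.continuous

variable {φ : F ⟶ yoneda.obj W} (hφ : Topology.IsQuotientMap (mapPoints φ))
include hφ

theorem exists_mem_range_of_isQuotientMap_mapPoints (x : W) :
    ∃ (X : Scheme.{u}) (g : yoneda.obj X ⟶ F) (h : X ⟶ W),
      g ≫ φ = yoneda.map h ∧ x ∈ Set.range h := by
  obtain ⟨t, rfl⟩ := (isQuotientMap_schemePoint.comp hφ).surjective x
  obtain ⟨X, g, y, rfl⟩ := exists_pointOf_eq t
  obtain ⟨h, hh⟩ := yoneda.map_surjective (g ≫ φ)
  refine ⟨X, g, h, hh.symm, y, ?_⟩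
  rw [← schemePoint_pointOf_map, hh]
  rfl

theorem isOpen_of_forall_isOpen_preimage {A : Set W}
    (hA : ∀ ⦃X : Scheme.{u}⦄ (g : yoneda.obj X ⟶ F) (h : X ⟶ W),
      g ≫ φ = yoneda.map h → IsOpen (h ⁻¹' A)) : IsOpen A := by
  refine (isQuotientMap_schemePoint.comp hφ).isOpen_preimage.1 fun X g _ ↦ ?_
  obtain ⟨h, hh⟩ := yoneda.map_surjective (g ≫ φ)
  have hpre : pointOf g ⁻¹' (schemePoint ∘ mapPoints φ ⁻¹' A) = h ⁻¹' A := by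
    rw [← pointOf_map_preimage_schemePoint_preimage, hh]
    rfl
  exact hpre ▸ hA g h hh.symm

end

/-- The morphisms `h : X ⟶ W` along which the section `w` of `G` lifts through `f`, that is, those
factoring through the fibre product `F ×_G W`. -/
def liftingPresieve {C : Type*} [Category* C] {F G : Cᵒᵖ ⥤ Type _} (f : F ⟶ G) {W : C}
    (w : yoneda.obj W ⟶ G) : Presieve W :=
  fun X ↦ {h | ∃ s : yoneda.obj X ⟶ F, s ≫ f = yoneda.map h ≫ w}

theorem liftingPresieve_comp {C : Type*} [Category* C] {F G : Cᵒᵖ ⥤ Type _} {f : F ⟶ G}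
    {W Y X : C} {w : yoneda.obj W ⟶ G} {q : Y ⟶ W} {h : X ⟶ Y}
    (hh : liftingPresieve f (yoneda.map q ≫ w) h) : liftingPresieve f w (h ≫ q) := by
  obtain ⟨s, hs⟩ := hh
  exact ⟨s, by simpa using hs⟩

/-- The morphism `f` is submersive after every étale base change. -/
def IsSubmersiveAfterEtaleBaseChange {S' S : AlgebraicSpace.{u}} (f : S' ⟶ S) : Prop :=
  ∀ ⦃T' T : AlgebraicSpace.{u}⦄ (g : T ⟶ S) (g' : T' ⟶ S') (f' : T' ⟶ T),
    AlgebraicSpace.IsEtale g → IsPullback g' f' f g → AlgebraicSpace.IsSubmersive f'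

section

variable {S' S : AlgebraicSpace.{u}} {f : S' ⟶ S} {W : Scheme.{u}} {w : yoneda.obj W ⟶ S.obj}

theorem liftingPresieve_of_comp_pullback_snd {X : Scheme.{u}}
    {g : yoneda.obj X ⟶ pullback f.hom w} {h : X ⟶ W}
    (hg : g ≫ pullback.snd f.hom w = yoneda.map h) : liftingPresieve f.hom w h :=
  ⟨g ≫ pullback.fst f.hom w, by rw [Category.assoc, pullback.condition, reassoc_of% hg]⟩

variable (hw : MorphismProperty.presheaf @Etale w)
include hw

theorem isQuotientMap_mapPoints_pullback_snd (hsub : IsSubmersiveAfterEtaleBaseChange f) :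
    Topology.IsQuotientMap (mapPoints (pullback.snd f.hom w)) := by
  have sq := IsPullback.of_hasPullback f.hom w
  let T : AlgebraicSpace.{u} := ⟨_, isAlgebraicSpace_yoneda_obj W⟩
  let T' : AlgebraicSpace.{u} :=
    ⟨_, isAlgebraicSpace_of_isPullback sq S'.property S.property hw.rep⟩
  let g : T ⟶ S := ObjectProperty.homMk w
  let g' : T' ⟶ S' := ObjectProperty.homMk (pullback.fst f.hom w)
  let f' : T' ⟶ T := ObjectProperty.homMk (pullback.snd f.hom w)
  refine hsub g g' f' ⟨W, 𝟙 _, presheaf_id_yoneda_obj (P := @Etale) inferInstance,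
    presheaf_id_yoneda_obj (P := @Surjective) inferInstance, by
      rwa [Category.id_comp]⟩ ?_
  exact IsPullback.of_map (ObjectProperty.ι _) (by ext1; exact sq.w) sq

theorem exists_liftingPresieve_mem_range (hsub : IsSubmersiveAfterEtaleBaseChange f) (x : W) :
    ∃ (X : Scheme.{u}) (h : X ⟶ W), liftingPresieve f.hom w h ∧ x ∈ Set.range h := by
  obtain ⟨X, g, h, hg, hx⟩ := exists_mem_range_of_isQuotientMap_mapPoints
    (isQuotientMap_mapPoints_pullback_snd hw hsub) x
  exact ⟨X, h, liftingPresieve_of_comp_pullback_snd hg, hx⟩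

theorem isOpen_of_forall_liftingPresieve (hsub : IsSubmersiveAfterEtaleBaseChange f) {A : Set W}
    (hA : ∀ ⦃X : Scheme.{u}⦄ (h : X ⟶ W), liftingPresieve f.hom w h → IsOpen (h ⁻¹' A)) :
    IsOpen A :=
  isOpen_of_forall_isOpen_preimage (isQuotientMap_mapPoints_pullback_snd hw hsub)
    fun _ _ h hg ↦ hA h (liftingPresieve_of_comp_pullback_snd hg)

theorem eq_zero_of_forall_liftingPresieve_appTop (hdom : AlgebraicSpace.IsSchematicallyDominant f)
    {s : Γ(W, ⊤)}
    (hs : ∀ ⦃X : Scheme.{u}⦄ (h : X ⟶ W), liftingPresieve f.hom w h → h.appTop s = 0) :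
    s = 0 := by
  refine (yonedaEquiv (X := W) (F := structurePresheaf.{u})).symm.injective
    (hdom w hw (hom_ext_yoneda fun X x ↦ ?_))
  obtain ⟨h, hh⟩ := yoneda.map_surjective (x ≫ pullback.snd f.hom w)
  have happ (t : Γ(W, ⊤)) : x ≫ pullback.snd f.hom w ≫
      (yonedaEquiv (F := structurePresheaf.{u})).symm t =
      (yonedaEquiv (F := structurePresheaf.{u})).symm (h.appTop t) := by
    rw [← reassoc_of% hh]
    exact yonedaEquiv_symm_naturality_left h structurePresheaf t
  rw [happ, happ, hs h (liftingPresieve_of_comp_pullback_snd hh.symm), map_zero]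

theorem eq_zero_of_forall_liftingPresieve (hdom : AlgebraicSpace.IsSchematicallyDominant f)
    {B : W.Opens} {s : Γ(W, B)}
    (hs : ∀ ⦃X : Scheme.{u}⦄ (h : X ⟶ W), liftingPresieve f.hom w h → h.app B s = 0) :
    s = 0 := by
  apply (ConcreteCategory.bijective_of_isIso B.topIso.inv).1
  rw [map_zero]
  refine eq_zero_of_forall_liftingPresieve_appTop (presheaf_etale_map_comp B.ι hw) hdom
    fun X h hh ↦ ?_
  have hle : (⊤ : X.Opens) ≤ (h ≫ B.ι) ⁻¹ᵁ B := fun x _ ↦ (h x).2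
  have happ : B.topIso.inv ≫ h.appTop =
      (h ≫ B.ι).app B ≫ X.presheaf.map (homOfLE hle).op := by
    have hinv : B.topIso.inv = B.ι.appLE B ⊤ B.ι_preimage_self.ge := by
      rw [Scheme.Opens.ι_appLE]
      rfl
    have htop : h.appTop = h.appLE ⊤ ⊤ h.preimage_top.ge := h.app_eq_appLE
    rw [hinv, htop, Scheme.Hom.appLE_comp_appLE]
    rfl
  rw [← ConcreteCategory.comp_apply, happ, ConcreteCategory.comp_apply,
    hs _ (liftingPresieve_comp hh), map_zero]

end

theorem exists_etale_lifting_pair {U V : Scheme.{u}} {Z : SchPresheaf.{u}} {v : yoneda.obj V ⟶ Z}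
    (hv : MorphismProperty.presheaf @Etale v) (a b : yoneda.obj U ⟶ Z) :
    ∃ (Q : Scheme.{u}) (q : Q ⟶ U) (r₁ r₂ : Q ⟶ V), Etale q ∧
      yoneda.map r₁ ≫ v = yoneda.map q ≫ a ∧ yoneda.map r₂ ≫ v = yoneda.map q ≫ b ∧
      ∀ ⦃X : Scheme.{u}⦄ (x : X ⟶ U) (y₁ y₂ : X ⟶ V), yoneda.map y₁ ≫ v = yoneda.map x ≫ a →
        yoneda.map y₂ ≫ v = yoneda.map x ≫ b →
          ∃ l : X ⟶ Q, l ≫ q = x ∧ l ≫ r₁ = y₁ ∧ l ≫ r₂ = y₂ := by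
  have hr : yoneda.relativelyRepresentable v := hv.rep
  have hq₁ : Etale (hr.snd a) := hv.property_snd _
  have hq₂ : Etale (hr.snd b) := hv.property_snd _
  refine ⟨pullback (hr.snd a) (hr.snd b), pullback.fst _ _ ≫ hr.snd a,
    pullback.fst _ _ ≫ hr.fst' a, pullback.snd _ _ ≫ hr.fst' b, inferInstance,
    ?_, ?_, fun X x y₁ y₂ h₁ h₂ ↦ ?_⟩
  · simp [hr.w]
  · rw [pullback.condition]
    simp [hr.w]
  · refine ⟨pullback.lift (hr.lift' y₁ x h₁) (hr.lift' y₂ x h₂) ?_, ?_, ?_, ?_⟩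
    · simp
    · rw [pullback.lift_fst_assoc, hr.lift'_snd]
    · rw [pullback.lift_fst_assoc, hr.lift'_fst]
    · rw [pullback.lift_snd_assoc, hr.lift'_fst]

theorem range_subset_range_equalizer_ι_comp {Q U V X : Scheme.{u}} {Z : SchPresheaf.{u}}
    {v : yoneda.obj V ⟶ Z} (hv : MorphismProperty.presheaf @Surjective v) {a b : yoneda.obj U ⟶ Z}
    {q : Q ⟶ U} {r₁ r₂ : Q ⟶ V}
    (exists_lift : ∀ ⦃Y : Scheme.{u}⦄ (x : Y ⟶ U) (y₁ y₂ : Y ⟶ V),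
      yoneda.map y₁ ≫ v = yoneda.map x ≫ a → yoneda.map y₂ ≫ v = yoneda.map x ≫ b →
        ∃ l : Y ⟶ Q, l ≫ q = x ∧ l ≫ r₁ = y₁ ∧ l ≫ r₂ = y₂)
    {h : X ⟶ U} (hab : yoneda.map h ≫ a = yoneda.map h ≫ b) :
    Set.range h ⊆ Set.range (equalizer.ι r₁ r₂ ≫ q) := by
  rintro _ ⟨x, rfl⟩
  obtain ⟨M, m, k, hm, hkm⟩ : ∃ (M : Scheme.{u}) (m : M ⟶ X) (k : M ⟶ V), Surjective m ∧
      yoneda.map k ≫ v = yoneda.map (m ≫ h) ≫ a :=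
    ⟨_, hv.rep.snd (yoneda.map h ≫ a), hv.rep.fst' (yoneda.map h ≫ a), hv.property_snd _,
      by simpa using hv.rep.w (yoneda.map h ≫ a)⟩
  obtain ⟨z, rfl⟩ := m.surjective x
  obtain ⟨l, hlq, hl₁, hl₂⟩ := exists_lift (m ≫ h) k k hkm (by
    rw [hkm, Functor.map_comp, Category.assoc, Category.assoc, hab])
  refine ⟨equalizer.lift l (hl₁.trans hl₂.symm) z, ?_⟩
  rw [← Scheme.Hom.comp_apply, equalizer.lift_ι_assoc, hlq, Scheme.Hom.comp_apply]

section

variable {S' S : AlgebraicSpace.{u}} {f : S' ⟶ S}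
  (hdom : AlgebraicSpace.IsSchematicallyDominant f) (hsub : IsSubmersiveAfterEtaleBaseChange f)
include hdom hsub

theorem isOpenImmersion_equalizer_ι_of_forall_liftingPresieve {V W : Scheme.{u}}
    {Z : SchPresheaf.{u}} {v : yoneda.obj V ⟶ Z} (hv : MorphismProperty.presheaf @Etale v)
    {w : yoneda.obj W ⟶ S.obj} (hw : MorphismProperty.presheaf @Etale w) {r₁ r₂ : W ⟶ V}
    (hr : ∀ ⦃X : Scheme.{u}⦄ (h : X ⟶ W), liftingPresieve f.hom w h →
      yoneda.map (h ≫ r₁) ≫ v = yoneda.map (h ≫ r₂) ≫ v) :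
    IsOpenImmersion (equalizer.ι r₁ r₂) :=
  isOpenImmersion_of_forall_pullback_snd (liftingPresieve f.hom w)
    (fun _ ↦ isOpen_of_forall_liftingPresieve hw hsub)
    (fun _ _ ↦ eq_zero_of_forall_liftingPresieve hw hdom)
    fun _ h hh ↦ isOpenImmersion_pullback_snd_equalizer_ι hv (hr h hh)

theorem hom_ext_of_forall_liftingPresieve {U : Scheme.{u}} {w : yoneda.obj U ⟶ S.obj}
    (hw : MorphismProperty.presheaf @Etale w) {Z : SchPresheaf.{u}} (hZ : IsAlgebraicSpace Z)
    {a b : yoneda.obj U ⟶ Z}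
    (hab : ∀ ⦃X : Scheme.{u}⦄ (h : X ⟶ U), liftingPresieve f.hom w h →
      yoneda.map h ≫ a = yoneda.map h ≫ b) : a = b := by
  obtain ⟨V, v, hv_etale, hv_surj⟩ := hZ.exists_atlas
  obtain ⟨Q, q, r₁, r₂, hq, hr₁, hr₂, exists_lift⟩ := exists_etale_lifting_pair hv_etale a b
  have hopen : IsOpenImmersion (equalizer.ι r₁ r₂) :=
    isOpenImmersion_equalizer_ι_of_forall_liftingPresieve hdom hsub hv_etale
      (presheaf_etale_map_comp q hw) fun X h hh ↦ by
        simpa [hr₁, hr₂] using hab (h ≫ q) (liftingPresieve_comp hh)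
  have hetale : Etale (equalizer.ι r₁ r₂ ≫ q) := inferInstance
  have hsurj : Surjective (equalizer.ι r₁ r₂ ≫ q) := ⟨fun x ↦ by
    obtain ⟨X, h, hh, hx⟩ := exists_liftingPresieve_mem_range hw hsub x
    exact range_subset_range_equalizer_ι_comp hv_surj exists_lift (hab h hh) hx⟩
  refine hom_ext_of_etale_surjective hZ.isSheaf (MorphismProperty.relative_map hetale)
    (MorphismProperty.relative_map hsurj) ?_
  rw [Functor.map_comp, Category.assoc, Category.assoc, ← hr₁, ← hr₂, ← Functor.map_comp_assoc,
    ← Functor.map_comp_assoc, equalizer.condition]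

theorem epi_of_isPullback {T' T : AlgebraicSpace.{u}} {g : T ⟶ S} {g' : T' ⟶ S'} {f' : T' ⟶ T}
    (hg : AlgebraicSpace.IsEtale g) (sq : IsPullback g' f' f g) : Epi f' := by
  obtain ⟨U, α, hα_etale, hα_surj, hαg⟩ := hg
  refine ⟨fun {Z} a b hab ↦ ObjectProperty.hom_ext _ ?_⟩
  refine hom_ext_of_etale_surjective Z.property.isSheaf hα_etale hα_surj ?_
  refine hom_ext_of_forall_liftingPresieve hdom hsub hαg Z.property fun X h ⟨s, hs⟩ ↦ ?_
  let X' : AlgebraicSpace.{u} := ⟨_, isAlgebraicSpace_yoneda_obj X⟩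
  let x : X' ⟶ T := ObjectProperty.homMk (yoneda.map h ≫ α)
  obtain ⟨l, -, hl⟩ := sq.exists_lift (ObjectProperty.homMk s : X' ⟶ S') x (by
    ext1
    simpa [x] using hs)
  have hx : x ≫ a = x ≫ b := by rw [← hl, Category.assoc, Category.assoc, hab]
  simpa [x] using congrArg (fun k : X' ⟶ Z ↦ k.hom) hx

end

theorem isEtale_id (S : AlgebraicSpace.{u}) : AlgebraicSpace.IsEtale (𝟙 S) := by
  obtain ⟨U, α, hα_etale, hα_surj⟩ := S.property.exists_atlas
  exact ⟨U, α, hα_etale, hα_surj, by simpa using hα_etale⟩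

end AlgebraicSpaceEpi

theorem mainTheorem11 {S' S : AlgebraicSpace.{u}} (f : S' ⟶ S)
    (hdom : AlgebraicSpace.IsSchematicallyDominant f)
    (hsub : ∀ ⦃T' T : AlgebraicSpace.{u}⦄ (g : T ⟶ S) (g' : T' ⟶ S') (f' : T' ⟶ T),
      AlgebraicSpace.IsEtale g → IsPullback g' f' f g → AlgebraicSpace.IsSubmersive f') :
    Epi f ∧
      ∀ ⦃T' T : AlgebraicSpace.{u}⦄ (g : T ⟶ S) (g' : T' ⟶ S') (f' : T' ⟶ T),
        AlgebraicSpace.IsEtale g → IsPullback g' f' f g → Epi f' := by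
  have hbase : ∀ ⦃T' T : AlgebraicSpace.{u}⦄ (g : T ⟶ S) (g' : T' ⟶ S') (f' : T' ⟶ T),
      AlgebraicSpace.IsEtale g → IsPullback g' f' f g → Epi f' :=
    fun _ _ _ _ _ hg sq ↦ AlgebraicSpaceEpi.epi_of_isPullback hdom hsub hg sq
  exact ⟨hbase (𝟙 S) (𝟙 S') f (AlgebraicSpaceEpi.isEtale_id S) .of_id_fst, hbase⟩
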